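/- For integers $m$, let $p(m)$ be the number of partitions of $m$, with $p(m)=0$ for $m<0$. For $n\geqslant 0$ let $b_6(n)$ be the number of $6$-regular partitions of $n$, that is, of partitions of $n$ with no part divisible by $6$. For $k>0$ and $n\geqslant 0$ let $\widetilde{P}_k(n)$ be the number of partitions of $n$ in which every positive integer $\leqslant k$ appears at least once as a part, there is a part larger than $k$, and the smallest part larger than $k$ appears at least $k+1$ times. Then for all integers $n\geqslant 0$ and $k>0$, $$(-1)^{k-1} \left(b_6(n) - \sum_{j=-k}^{k} (-1)^j\, p\big(n-3j(3j-1)\big) \right) = \sum_{j=0}^{\lfloor n/6 \rfloor} b_6(n-6j)\, \widetilde{P}_k(j).$$ -/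

import Mathlib

/-- Euler's partition function `p(m)` for an integer `m`, with `p(m) = 0` for `m < 0`. -/
def eulerP (m : ℤ) : ℕ :=
  if 0 ≤ m then Fintype.card (Nat.Partition m.toNat) else 0

/-- `b_ℓ(n)`: the number of `ℓ`-regular partitions of `n`, i.e. of those with no part
divisible by `ℓ`. -/
def regularPartitions (ℓ n : ℕ) : ℕ :=
  (Nat.Partition.restricted n (fun i => ¬ ℓ ∣ i)).card

/-- The Xia–Zhao condition on a partition `π`: each of `1, …, k` is a part of `π`, there is a part
larger than `k`, and the least part larger than `k` appears at least `k + 1` times. -/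
def IsXiaZhao (k : ℕ) {n : ℕ} (π : Nat.Partition n) : Prop :=
  (∀ i ∈ Finset.Icc 1 k, i ∈ π.parts) ∧
    ∃ m ∈ π.parts, k < m ∧ (∀ i ∈ π.parts, k < i → m ≤ i) ∧ k + 1 ≤ π.parts.count m

/-- `P̃_k(n)`: the number of partitions of `n` satisfying the Xia–Zhao condition for `k`. -/
noncomputable def xiaZhaoP (k n : ℕ) : ℕ :=
  Nat.card {π : Nat.Partition n // IsXiaZhao k π}

open PowerSeries PowerSeries.WithPiTopology Filter Topology

/-! Write `E` for Euler's product and `S k` for `eulerSeries k`. Euler's recurrence `S k + X ^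
(3k+1) * S (k+1) = 1 + X ^ k` drives an induction on `k` showing that the pentagonal series
truncated at `k` is `E + (-1) ^ k * X ^ pentagonal (k+1) * S (k+1)` (`truncatedPentagonal_eq`). The
error term is a partition count times `E`: sort the Xia–Zhao partitions by their least part `k+1+r`
above `k` and delete the forced parts. What remains has no part strictly between `k` and `k+1+r`, so
multiplication by `E` leaves the `r`-th term of `S (k+1)`, up to the power of `X`
(`xiaZhaoSeries_mul_eulerProduct`). Finally put `X ^ 6` for `X` and divide by `E`: the quotient `E(X
^ 6) / E` generates the 6-regular partitions, and coefficients are compared. -/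

/-- The generating function of the partitions all of whose parts satisfy `p`. -/
noncomputable def restrictedSeries (p : ℕ → Prop) [DecidablePred p] : ℤ⟦X⟧ :=
  PowerSeries.mk fun n ↦ ((Nat.Partition.restricted n p).card : ℤ)

/-- Euler's product `∏ (1 - X ^ i)` over `i ≥ 1`. -/
noncomputable def eulerProduct : ℤ⟦X⟧ := ∏' i : ℕ, (1 - X ^ (i + 1))

/-- Each allowed part `i` contributes a geometric series, which the factor `1 - X ^ i` cancels. -/
theorem restrictedSeries_mul_eulerProduct (p : ℕ → Prop) [DecidablePred p] :
    restrictedSeries p * eulerProduct =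
      ∏' i : ℕ, if p (i + 1) then (1 : ℤ⟦X⟧) else 1 - X ^ (i + 1) := by
  rw [restrictedSeries, eulerProduct, Nat.Partition.powerSeriesMk_card_restricted_eq_tprod,
    ← (Nat.Partition.multipliable_powerSeriesMk_card_restricted ℤ p).tprod_mul
      (multipliable_one_sub_X_pow _)]
  refine tprod_congr fun i ↦ ?_
  split_ifs
  · simp_rw [pow_mul]
    exact tsum_pow_mul_one_sub_of_constantCoeff_eq_zero (by simp)
  · simp

theorem restrictedSeries_true_mul_eulerProduct :
    restrictedSeries (fun _ ↦ True) * eulerProduct = 1 := by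
  simp [restrictedSeries_mul_eulerProduct]

theorem restrictedSeries_gap_mul_eulerProduct (k r : ℕ) :
    restrictedSeries (fun i ↦ ¬ (k < i ∧ i < k + 1 + r)) * eulerProduct =
      ∏ i ∈ Finset.range r, (1 - X ^ (k + 1 + i)) := by
  rw [restrictedSeries_mul_eulerProduct, tprod_eq_prod (s := Finset.Ico k (k + r)),
    Finset.prod_Ico_eq_prod_range]
  · rw [Nat.add_sub_cancel_left]
    refine Finset.prod_congr rfl fun i hi ↦ ?_
    have := Finset.mem_range.mp hi
    rw [if_neg (by omega), show k + i + 1 = k + 1 + i by ring]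
  · intro i hi
    rw [Finset.mem_Ico] at hi
    rw [if_pos (by omega)]

theorem continuous_expand (p : ℕ) (hp : p ≠ 0) :
    Continuous (expand p hp : ℤ⟦X⟧ → ℤ⟦X⟧) := by
  refine continuous_iff_continuousAt.mpr fun f ↦ (tendsto_iff_coeff_tendsto _ _ _ _).mpr fun d ↦ ?_
  simp_rw [coeff_expand]
  split_ifs
  · exact (continuous_coeff ℤ _).continuousAt
  · exact tendsto_const_nhds

theorem expand_eulerProduct {m : ℕ} (hm : m ≠ 0) :
    expand m hm eulerProduct = ∏' i : ℕ, (1 - X ^ ((i + 1) * m)) := by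
  have h := (multipliable_one_sub_X_pow ℤ).hasProd.map (expand m hm) (continuous_expand m hm)
  rw [eulerProduct, ← h.tprod_eq]
  refine tprod_congr fun i ↦ ?_
  simp [← pow_mul, mul_comm]

theorem restrictedSeries_not_dvd_mul_eulerProduct {m : ℕ} (hm : m ≠ 0) :
    restrictedSeries (fun i ↦ ¬ m ∣ i) * eulerProduct = expand m hm eulerProduct := by
  rw [restrictedSeries_mul_eulerProduct, expand_eulerProduct]
  have hpos : 0 < m := Nat.pos_of_ne_zero hm
  have hsub (i : ℕ) : (i + 1) * m - 1 + 1 = (i + 1) * m :=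
    Nat.sub_add_cancel (Nat.mul_pos i.succ_pos hpos)
  have hinj : Function.Injective fun i : ℕ ↦ (i + 1) * m - 1 := by
    intro a b h
    have h' : (a + 1) * m = (b + 1) * m := by rw [← hsub a, ← hsub b]; exact congrArg (· + 1) h
    simpa using Nat.eq_of_mul_eq_mul_right hpos h'
  -- Only the indices `(i + 1) * m - 1` carry a factor other than 1.
  rw [← hinj.tprod_eq]
  · refine tprod_congr fun i ↦ ?_
    simp [hsub]
  · intro i hi
    have hd : m ∣ i + 1 := by
      by_contra hd
      simp [hd] at hi
    obtain ⟨j, hj⟩ := hd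
    have hj0 : j ≠ 0 := by rintro rfl; simp at hj
    refine ⟨j - 1, ?_⟩
    simp only
    rw [Nat.sub_add_cancel (Nat.one_le_iff_ne_zero.mpr hj0), mul_comm, ← hj, Nat.add_sub_cancel]

/-! ### Euler's series and its recurrence -/

/-- The terms of Euler's series `∑ X ^ (k * r) * (1 - X ^ k) ⋯ (1 - X ^ (k + r - 1))`. -/
noncomputable def eulerTerm (k r : ℕ) : ℤ⟦X⟧ :=
  X ^ (k * r) * ∏ i ∈ Finset.range r, (1 - X ^ (k + i))

theorem tendsto_X_pow_mul_zero (e : ℕ → ℕ) (he : ∀ n, n < e n) (f : ℕ → ℤ⟦X⟧) :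
    Tendsto (fun n ↦ X ^ e n * f n) atTop (𝓝 0) := by
  refine (tendsto_iff_coeff_tendsto _ _ _ _).mpr fun d ↦ tendsto_atTop_of_eventually_const
    fun n (hn : n ≥ d) ↦ ?_
  rw [coeff_X_pow_mul', if_neg (by have := he n; omega), map_zero]

theorem summable_eulerTerm {k : ℕ} (hk : 0 < k) : Summable (eulerTerm k) := by
  refine summable_of_tendsto_order_atTop_nhds_top _ ?_
  refine ENat.tendsto_nhds_top_iff_natCast_lt.mpr fun n ↦ eventually_atTop.mpr ⟨n + 1, ?_⟩
  intro r hr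
  rw [eulerTerm]
  grw [← le_order_mul, order_X_pow]
  refine lt_add_of_lt_of_nonneg ?_ (by simp)
  norm_cast
  nlinarith

/-- Euler's series, the sum of `eulerTerm k`. -/
noncomputable def eulerSeries (k : ℕ) : ℤ⟦X⟧ := ∑' r, eulerTerm k r

theorem eulerTerm_succ_right (k r : ℕ) :
    eulerTerm k (r + 1) = X ^ (k * (r + 1)) * ((1 - X ^ k) *
      ∏ i ∈ Finset.range r, (1 - X ^ (k + 1 + i))) := by
  rw [eulerTerm, Finset.prod_range_succ', mul_comm (∏ _ ∈ _, _)]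
  simp only [add_zero]
  congr 2
  refine Finset.prod_congr rfl fun i _ ↦ ?_
  rw [show k + (i + 1) = k + 1 + i by ring]

/-- The remainder is divisible by `X ^ (k * (N + 1))`, so for `k > 0` it vanishes in the limit. -/
theorem sum_eulerTerm_add (k N : ℕ) :
    ∑ r ∈ Finset.range (N + 1), (eulerTerm k r + X ^ (3 * k + 1) * eulerTerm (k + 1) r) =
      1 + X ^ k - X ^ (k * (N + 1)) * ((∏ i ∈ Finset.range N, (1 - X ^ (k + 1 + i))) *
        (1 - X ^ (2 * k + N + 1))) := by
  induction N with
  | zero =>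
    simp [eulerTerm]
    ring
  | succ N ih =>
    rw [Finset.sum_range_succ, ih, eulerTerm_succ_right, eulerTerm, Finset.prod_range_succ]
    ring

theorem eulerSeries_add {k : ℕ} (hk : 0 < k) :
    eulerSeries k + X ^ (3 * k + 1) * eulerSeries (k + 1) = 1 + X ^ k := by
  have h := ((summable_eulerTerm hk).hasSum.add
    ((summable_eulerTerm k.succ_pos).hasSum.mul_left (X ^ (3 * k + 1)))).tendsto_sum_nat
  refine tendsto_nhds_unique (h.comp (tendsto_add_atTop_nat 1)) ?_
  simp_rw [Function.comp_def, sum_eulerTerm_add]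
  have := (tendsto_X_pow_mul_zero (fun N ↦ k * (N + 1)) (fun n ↦ by nlinarith)
    fun N ↦ (∏ i ∈ Finset.range N, (1 - X ^ (k + 1 + i))) * (1 - X ^ (2 * k + N + 1))).const_sub
      (1 + X ^ k)
  simpa using this

/-- The terms are differences of consecutive partial products of `E`, so the sum telescopes. -/
theorem X_mul_eulerSeries_one : X * eulerSeries 1 = 1 - eulerProduct := by
  have h := ((summable_eulerTerm one_pos).hasSum.mul_left X).tendsto_sum_nat
  refine tendsto_nhds_unique h ?_
  have hsum (N : ℕ) : ∑ r ∈ Finset.range N, X * eulerTerm 1 r =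
      1 - ∏ i ∈ Finset.range N, (1 - X ^ (i + 1)) := by
    induction N with
    | zero => simp
    | succ N ih =>
      rw [Finset.sum_range_succ, ih, Finset.prod_range_succ, eulerTerm]
      simp_rw [add_comm 1]
      ring
  simp_rw [hsum]
  exact (multipliable_one_sub_X_pow ℤ).hasProd.tendsto_prod_nat.const_sub 1

/-! ### The truncated pentagonal number series -/

/-- The pentagonal number series truncated to the indices `-k, …, k`. -/
noncomputable def truncatedPentagonal (k : ℕ) : ℤ⟦X⟧ :=
  ∑ j ∈ Finset.Icc (-(k : ℤ)) k, ((j.negOnePow : ℤ) : ℤ⟦X⟧) * X ^ pentagonal j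

theorem truncatedPentagonal_succ (k : ℕ) :
    truncatedPentagonal (k + 1) = truncatedPentagonal k +
      (-1) ^ (k + 1) * X ^ pentagonal (k + 1) * (1 + X ^ (k + 1)) := by
  have hIcc : Finset.Icc (-((k + 1 : ℕ) : ℤ)) (k + 1 : ℕ) =
      insert (-((k : ℤ) + 1)) (insert ((k : ℤ) + 1) (Finset.Icc (-(k : ℤ)) k)) := by
    ext j
    simp only [Finset.mem_Icc, Finset.mem_insert]
    push_cast
    omega
  have hneg : pentagonal (-((k : ℤ) + 1)) = pentagonal (k + 1) + (k + 1) := by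
    have h1 := two_mul_natCast_pentagonal_neg ((k : ℤ) + 1)
    have h2 := two_mul_natCast_pentagonal ((k : ℤ) + 1)
    zify
    linarith
  have hsign : (((k : ℤ) + 1).negOnePow : ℤ) = (-1) ^ (k + 1) := by
    exact_mod_cast Int.coe_negOnePow_natCast (k + 1)
  rw [truncatedPentagonal, hIcc, Finset.sum_insert, Finset.sum_insert, hneg, Int.negOnePow_neg,
    hsign, truncatedPentagonal]
  · push_cast
    ring
  · simp
  · simp only [Finset.mem_insert, Finset.mem_Icc]
    omega

theorem truncatedPentagonal_eq (k : ℕ) :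
    truncatedPentagonal k =
      eulerProduct + (-1) ^ k * (X ^ pentagonal (k + 1) * eulerSeries (k + 1)) := by
  induction k with
  | zero =>
    have h := X_mul_eulerSeries_one
    have h1 : pentagonal 1 = 1 := by simp [pentagonal_def]
    have h0 : pentagonal 0 = 0 := by simp [pentagonal_def]
    simp [truncatedPentagonal, h1, h0, h]
  | succ k ih =>
    have hp : pentagonal ((k + 1 : ℕ) + 1) = pentagonal (k + 1) + (3 * (k + 1) + 1) := by
      have h1 := two_mul_natCast_pentagonal ((k + 1 : ℕ) + 1)
      have h2 := two_mul_natCast_pentagonal ((k : ℤ) + 1)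
      zify
      push_cast at h1 ⊢
      linarith
    rw [truncatedPentagonal_succ, ih, hp, ← eulerSeries_add k.succ_pos]
    simp only [Nat.succ_eq_add_one]
    ring

/-! ### Counting Xia–Zhao partitions -/

/-- The generating function of `xiaZhaoP k`. -/
noncomputable def xiaZhaoSeries (k : ℕ) : ℤ⟦X⟧ := PowerSeries.mk fun n ↦ (xiaZhaoP k n : ℤ)

/-- Removing `M` from the parts is a bijection, with inverse adding `M`. -/
theorem card_filter_le_parts (n : ℕ) (p : ℕ → Prop) [DecidablePred p] (M : Multiset ℕ)
    (hM : ∀ i ∈ M, 0 < i ∧ p i) :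
    (Finset.univ.filter fun π : n.Partition ↦ M ≤ π.parts ∧ ∀ i ∈ π.parts, p i).card =
      if M.sum ≤ n then (Nat.Partition.restricted (n - M.sum) p).card else 0 := by
  split_ifs with h
  · refine Finset.card_bij'
      (i := fun π hπ ↦ ⟨π.parts - M, fun hi ↦ π.parts_pos (Multiset.mem_of_le
        (Multiset.sub_le_self _ _) hi), ?_⟩)
      (j := fun π hπ ↦ ⟨M + π.parts, fun hi ↦ ?_, ?_⟩) ?_ ?_ ?_ ?_
    · have h1 := (Finset.mem_filter.mp hπ).2.1
      have h3 := congrArg Multiset.sum (add_tsub_cancel_of_le h1)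
      rw [Multiset.sum_add, π.parts_sum] at h3
      omega
    · rcases Multiset.mem_add.mp hi with hi | hi
      · exact (hM _ hi).1
      · exact π.parts_pos hi
    · rw [Multiset.sum_add, π.parts_sum]
      omega
    · intro π hπ
      simp only [Nat.Partition.restricted, Finset.mem_filter, Finset.mem_univ, true_and] at hπ ⊢
      exact fun i hi ↦ hπ.2 i (Multiset.mem_of_le (Multiset.sub_le_self _ _) hi)
    · intro π hπ
      simp only [Nat.Partition.restricted, Finset.mem_filter, Finset.mem_univ, true_and,
        Multiset.mem_add] at hπ ⊢
      exact ⟨Multiset.le_add_right _ _, fun i hi ↦ hi.elim (fun hi ↦ (hM i hi).2) (hπ i)⟩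
    · intro π hπ
      exact Nat.Partition.ext (add_tsub_cancel_of_le (Finset.mem_filter.mp hπ).2.1)
    · intro π hπ
      exact Nat.Partition.ext (add_tsub_cancel_left _ _)
  · rw [Finset.card_eq_zero, Finset.filter_eq_empty_iff]
    rintro π - ⟨h1, -⟩
    have h2 := congrArg Multiset.sum (add_tsub_cancel_of_le h1)
    rw [Multiset.sum_add, π.parts_sum] at h2
    omega

/-- The parts that the Xia–Zhao condition forces when the least part larger than `k` is `m`. -/
def forcedParts (k m : ℕ) : Multiset ℕ := (Finset.Icc 1 k).val + Multiset.replicate (k + 1) m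

theorem forcedParts_le_iff {k m : ℕ} (hm : k < m) (s : Multiset ℕ) :
    forcedParts k m ≤ s ↔ (∀ i ∈ Finset.Icc 1 k, i ∈ s) ∧ k + 1 ≤ s.count m := by
  have hcount (i : ℕ) : (forcedParts k m).count i =
      (if i ∈ Finset.Icc 1 k then 1 else 0) + if m = i then k + 1 else 0 := by
    rw [forcedParts, Multiset.count_add, Multiset.count_replicate,
      Multiset.count_eq_of_nodup (Finset.nodup _)]
    rfl
  rw [Multiset.le_iff_count]
  simp_rw [hcount]
  constructor
  · refine fun h ↦ ⟨fun i hi ↦ ?_, ?_⟩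
    · have := h i
      rw [if_pos hi] at this
      exact Multiset.count_pos.mp (by omega)
    · have := h m
      rw [if_pos rfl] at this
      omega
  · rintro ⟨h1, h2⟩ i
    by_cases hi : i ∈ Finset.Icc 1 k
    · have := Multiset.count_pos.mpr (h1 i hi)
      have hne : m ≠ i := by rintro rfl; rw [Finset.mem_Icc] at hi; omega
      rw [if_pos hi, if_neg hne]
      omega
    · rw [if_neg hi]
      split_ifs with hmi
      · subst hmi; omega
      · omega

/-- At `r = 0` this is `k(k+1)/2 + (k+1)² = (k+1)(3k+2)/2`. -/
theorem sum_forcedParts (k r : ℕ) :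
    (forcedParts k (k + 1 + r)).sum = pentagonal (k + 1) + (k + 1) * r := by
  have h : 2 * ∑ i ∈ Finset.Icc 1 k, i = k * (k + 1) := by
    induction k with
    | zero => simp
    | succ k ih => rw [Finset.sum_Icc_succ_top (by omega), mul_add, ih]; ring
  have hs : (forcedParts k (k + 1 + r)).sum = ∑ i ∈ Finset.Icc 1 k, i + (k + 1) * (k + 1 + r) := by
    rw [forcedParts, Multiset.sum_add, Multiset.sum_replicate, smul_eq_mul, Finset.sum_val]
    rfl
  have hp := two_mul_natCast_pentagonal ((k : ℤ) + 1)
  rw [hs]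
  zify at h ⊢
  linarith

theorem isXiaZhao_iff {k n : ℕ} (π : n.Partition) :
    IsXiaZhao k π ↔ ∃ r ∈ Finset.range (n + 1), forcedParts k (k + 1 + r) ≤ π.parts ∧
      ∀ i ∈ π.parts, ¬ (k < i ∧ i < k + 1 + r) := by
  constructor
  · rintro ⟨h1, m, hm, hkm, h2, h3⟩
    obtain ⟨r, rfl⟩ := Nat.exists_eq_add_of_le (Nat.succ_le_of_lt hkm)
    have := Nat.Partition.le_of_mem_parts hm
    exact ⟨r, Finset.mem_range.mpr (by omega), (forcedParts_le_iff hkm _).mpr ⟨h1, h3⟩,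
      fun i hi h ↦ absurd (h2 i hi h.1) (by omega)⟩
  · rintro ⟨r, -, h1, h2⟩
    rw [forcedParts_le_iff (by omega)] at h1
    refine ⟨h1.1, k + 1 + r, Multiset.count_pos.mp (by omega), by omega, fun i hi hk ↦ ?_, h1.2⟩
    have := h2 i hi
    omega

theorem xiaZhaoP_eq_sum (k n : ℕ) :
    xiaZhaoP k n = ∑ r ∈ Finset.range (n + 1), (Finset.univ.filter fun π : n.Partition ↦
      forcedParts k (k + 1 + r) ≤ π.parts ∧
        ∀ i ∈ π.parts, ¬ (k < i ∧ i < k + 1 + r)).card := by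
  classical
  rw [xiaZhaoP, Nat.card_eq_fintype_card, Fintype.card_subtype, ← Finset.card_biUnion]
  · congr 1
    ext π
    simp [isXiaZhao_iff]
  -- The classes are disjoint: the part `k + 1 + r` lies in the gap prescribed by any `s > r`.
  · have key {r s : ℕ} {π : n.Partition} (hrs : r < s)
        (h1 : forcedParts k (k + 1 + r) ≤ π.parts)
        (h2 : ∀ i ∈ π.parts, ¬ (k < i ∧ i < k + 1 + s)) : False := by
      rw [forcedParts_le_iff (by omega)] at h1
      exact h2 (k + 1 + r) (Multiset.count_pos.mp (by omega)) ⟨by omega, by omega⟩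
    intro r _ s _ hrs
    rw [Function.onFun, Finset.disjoint_left]
    intro π h1 h2
    have h1 := (Finset.mem_filter.mp h1).2
    have h2 := (Finset.mem_filter.mp h2).2
    rcases lt_or_gt_of_ne hrs with h | h
    · exact key h h1.1 h2.2
    · exact key h h2.1 h1.2

theorem hasSum_xiaZhaoSeries (k : ℕ) :
    HasSum (fun r ↦ X ^ (pentagonal (k + 1) + (k + 1) * r) *
      restrictedSeries (fun i ↦ ¬ (k < i ∧ i < k + 1 + r))) (xiaZhaoSeries k) := by
  rw [hasSum_iff_hasSum_coeff]
  intro n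
  have hcoeff (r : ℕ) : coeff n (X ^ (pentagonal (k + 1) + (k + 1) * r) *
      restrictedSeries (fun i ↦ ¬ (k < i ∧ i < k + 1 + r))) =
      ((Finset.univ.filter fun π : n.Partition ↦ forcedParts k (k + 1 + r) ≤ π.parts ∧
        ∀ i ∈ π.parts, ¬ (k < i ∧ i < k + 1 + r)).card : ℤ) := by
    rw [card_filter_le_parts, sum_forcedParts, coeff_X_pow_mul', restrictedSeries, coeff_mk]
    · split_ifs <;> rfl
    · intro i hi
      rw [forcedParts, Multiset.mem_add, Finset.mem_val, Finset.mem_Icc] at hi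
      rcases hi with hi | hi
      · omega
      · have := Multiset.eq_of_mem_replicate hi
        omega
  rw [xiaZhaoSeries, coeff_mk, xiaZhaoP_eq_sum, Nat.cast_sum]
  simp_rw [← hcoeff]
  -- For `r > n` the exponent of `X` exceeds `n`.
  refine hasSum_sum_of_ne_finset_zero fun r hr ↦ ?_
  rw [coeff_X_pow_mul', if_neg]
  rw [Finset.mem_range] at hr
  nlinarith

theorem xiaZhaoSeries_mul_eulerProduct (k : ℕ) :
    xiaZhaoSeries k * eulerProduct = X ^ pentagonal (k + 1) * eulerSeries (k + 1) := by
  refine ((hasSum_xiaZhaoSeries k).mul_right eulerProduct).unique ?_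
  have h : HasSum (eulerTerm (k + 1)) (eulerSeries (k + 1)) :=
    (summable_eulerTerm k.succ_pos).hasSum
  convert h.mul_left (X ^ pentagonal (k + 1)) using 2 with r
  rw [mul_assoc, restrictedSeries_gap_mul_eulerProduct, eulerTerm, pow_add, mul_assoc]

/-- The truncated pentagonal number theorem of Xia and Zhao. -/
theorem truncatedPentagonal_eq_mul (k : ℕ) :
    truncatedPentagonal k = (1 + (-1) ^ k * xiaZhaoSeries k) * eulerProduct := by
  rw [truncatedPentagonal_eq, ← xiaZhaoSeries_mul_eulerProduct]
  ring

/-! ### Dilation and comparison of coefficients -/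

theorem restrictedSeries_mul_expand_truncatedPentagonal {m : ℕ} (hm : m ≠ 0) (k : ℕ) :
    restrictedSeries (fun _ ↦ True) * expand m hm (truncatedPentagonal k) =
      restrictedSeries (fun i ↦ ¬ m ∣ i) * (1 + (-1) ^ k * expand m hm (xiaZhaoSeries k)) := by
  rw [truncatedPentagonal_eq_mul, map_mul, ← restrictedSeries_not_dvd_mul_eulerProduct hm]
  simp only [map_add, map_mul, map_pow, map_neg, map_one]
  linear_combination (restrictedSeries (fun i ↦ ¬ m ∣ i) *
    (1 + (-1) ^ k * expand m hm (xiaZhaoSeries k))) * restrictedSeries_true_mul_eulerProduct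

theorem coeff_mul_expand {m : ℕ} (hm : m ≠ 0) (f g : ℤ⟦X⟧) (n : ℕ) :
    coeff n (f * expand m hm g) =
      ∑ j ∈ Finset.range (n / m + 1), coeff (n - m * j) f * coeff j g := by
  have hpos : 0 < m := Nat.pos_of_ne_zero hm
  rw [mul_comm, coeff_mul, Finset.Nat.sum_antidiagonal_eq_sum_range_succ
    (fun i j ↦ coeff i (expand m hm g) * coeff j f)]
  symm
  refine Finset.sum_of_injOn (fun j ↦ m * j) ?_ ?_ ?_ ?_
  · exact fun a _ b _ h ↦ Nat.eq_of_mul_eq_mul_left hpos h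
  · intro j hj
    simp only [Finset.coe_range, Set.mem_Iio, Nat.lt_succ_iff] at hj ⊢
    exact (Nat.mul_le_mul_left m hj).trans (Nat.mul_div_le n m)
  · intro i hi hi'
    rw [coeff_expand_of_not_dvd, zero_mul]
    rintro ⟨j, rfl⟩
    refine hi' ⟨j, ?_, rfl⟩
    simp only [Finset.coe_range, Set.mem_Iio, Finset.mem_range, Nat.lt_succ_iff] at hi ⊢
    rwa [Nat.le_div_iff_mul_le hpos, mul_comm]
  · intro j _
    rw [coeff_expand_mul, mul_comm]

theorem eulerP_natCast_sub (n e : ℕ) :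
    (eulerP ((n : ℤ) - e) : ℤ) = coeff n (restrictedSeries (fun _ ↦ True) * X ^ e) := by
  rw [coeff_mul_X_pow', eulerP]
  by_cases h : e ≤ n
  · rw [if_pos (by omega), if_pos h, restrictedSeries, coeff_mk, ← Nat.cast_sub h,
      Int.toNat_natCast]
    simp [Nat.Partition.restricted]
  · rw [if_neg (by omega), if_neg h, Nat.cast_zero]

theorem coeff_mul_expand_truncatedPentagonal (n k : ℕ) :
    coeff n (restrictedSeries (fun _ ↦ True) * expand 6 (by norm_num) (truncatedPentagonal k)) =
      ∑ j ∈ Finset.Icc (-(k : ℤ)) (k : ℤ),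
        (j.negOnePow : ℤ) * (eulerP ((n : ℤ) - 3 * j * (3 * j - 1)) : ℤ) := by
  rw [truncatedPentagonal, map_sum, Finset.mul_sum, map_sum]
  refine Finset.sum_congr rfl fun j _ ↦ ?_
  have hj : 3 * j * (3 * j - 1) = ((6 * pentagonal j : ℕ) : ℤ) := by
    have := two_mul_natCast_pentagonal j
    push_cast
    linarith
  rw [hj, eulerP_natCast_sub, map_mul (expand 6 _), map_intCast, map_pow, expand_X, ← pow_mul,
    mul_left_comm, ← zsmul_eq_mul, map_zsmul, smul_eq_mul]

theorem mainTheorem6 (n k : ℕ) (hk : 0 < k) :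
    (-1 : ℤ) ^ (k - 1) *
        ((regularPartitions 6 n : ℤ) -
          ∑ j ∈ Finset.Icc (-(k : ℤ)) (k : ℤ),
            (j.negOnePow : ℤ) * (eulerP ((n : ℤ) - 3 * j * (3 * j - 1)) : ℤ)) =
      ∑ j ∈ Finset.range (n / 6 + 1),
        (regularPartitions 6 (n - 6 * j) : ℤ) * (xiaZhaoP k j : ℤ) := by
  obtain ⟨k, rfl⟩ := Nat.exists_eq_add_one_of_ne_zero hk.ne'
  have hreg (m : ℕ) : (regularPartitions 6 m : ℤ) =
      coeff m (restrictedSeries fun i ↦ ¬ 6 ∣ i) := by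
    rw [restrictedSeries, coeff_mk, regularPartitions]
  have hxz (m : ℕ) : (xiaZhaoP (k + 1) m : ℤ) = coeff m (xiaZhaoSeries (k + 1)) := by
    rw [xiaZhaoSeries, coeff_mk]
  have hsign : ((-1 : ℤ⟦X⟧) ^ (k + 1)) = C ((-1 : ℤ) ^ (k + 1)) := by simp
  simp_rw [← coeff_mul_expand_truncatedPentagonal, hreg, hxz]
  rw [← coeff_mul_expand (by norm_num : 6 ≠ 0), restrictedSeries_mul_expand_truncatedPentagonal,
    mul_add, mul_one, mul_left_comm, hsign, map_add, coeff_C_mul, Nat.add_sub_cancel, pow_succ]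
  have := pow_mul_pow_eq_one k (show (-1 : ℤ) * -1 = 1 by norm_num)
  linear_combination (coeff n ((restrictedSeries fun i ↦ ¬ 6 ∣ i) *
    expand 6 (by norm_num) (xiaZhaoSeries (k + 1)))) * this
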